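/- Let $p$ be an odd prime. Let $ES_p(p^3)=\langle \alpha,\alpha_1,\alpha_2 \mid [\alpha_1,\alpha]=\alpha_2,\ [\alpha,\alpha_2]=[\alpha_1,\alpha_2]=1,\ \alpha^{p}=\alpha_1^p=\alpha_2^p=1\rangle$ be the extraspecial group of order $p^3$ and exponent $p$, and let $\phi_2(211)c=\langle \alpha,\alpha_1,\alpha_2 \mid [\alpha_1,\alpha]=\alpha_2,\ [\alpha,\alpha_2]=[\alpha_1,\alpha_2]=1,\ \alpha^{p^2}=\alpha_1^p=\alpha_2^p=1\rangle$. Put $$H_1=\phi_2(2111)d=ES_p(p^3)\times C_{p^2},\qquad H_2=\phi_2(2111)c=\phi_2(211)c\times C_p,$$ where $C_n$ denotes the cyclic group of order $n$. For a group $G$ and a $2$-cocycle $c\in Z^2(G,\mathbb C^\times)$ (trivial action of $G$ on $\mathbb C^\times$), let $\mathbb C^{c}G$ be the twisted group algebra, i.e. the $\mathbb C$-algebra with basis $(e_g)_{g\in G}$ and multiplication $e_ge_h=c(g,h)e_{gh}$; up to isomorphism it depends only on the class $[c]\in H^2(G,\mathbb C^\times)$. Then $H_1$ and $H_2$ are $\mathbb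 C$-twist isomorphic: there is a group isomorphism $\psi:H^2(H_1,\mathbb C^\times)\to H^2(H_2,\mathbb C^\times)$ such that for all $c\in Z^2(H_1,\mathbb C^\times)$ and $d\in Z^2(H_2,\mathbb C^\times)$ with $\psi([c])=[d]$, the $\mathbb C$-algebras $\mathbb C^{c}H_1$ and $\mathbb C^{d}H_2$ are isomorphic. -/

import Mathlib

noncomputable section

/-- `Rˣ` (written additively) as a `G`-module with trivial action. -/
abbrev unitsRep (G R : Type) [Group G] [CommRing R] : Rep ℤ G :=
  Rep.trivial ℤ G (Additive Rˣ)

/-- The group `Z²(G, Rˣ)` of 2-cocycles of `G` with values in the trivial `G`-module `Rˣ`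
(not necessarily normalized). -/
abbrev TwoCocycle (G R : Type) [Group G] [CommRing R] : Type :=
  groupCohomology.cocycles₂ (unitsRep G R)

/-- The second cohomology group `H²(G, Rˣ)`. -/
abbrev SchurH2 (G R : Type) [Group G] [CommRing R] : Type :=
  groupCohomology.H2 (unitsRep G R)

/-- The cohomology class `[c] ∈ H²(G, Rˣ)` of a 2-cocycle `c`. -/
abbrev TwoCocycle.cls {G R : Type} [Group G] [CommRing R] (c : TwoCocycle G R) : SchurH2 G R :=
  (groupCohomology.H2π (unitsRep G R)).hom c

/-- The value `c(g, h) ∈ Rˣ` of a 2-cocycle. -/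
def TwoCocycle.val {G R : Type} [Group G] [CommRing R] (c : TwoCocycle G R) (g h : G) : Rˣ :=
  Additive.toMul (c.1 (g, h))

theorem TwoCocycle.val_assoc {G R : Type} [Group G] [CommRing R] (c : TwoCocycle G R)
    (g h k : G) : c.val (g * h) k * c.val g h = c.val h k * c.val g (h * k) :=
  congrArg Additive.toMul ((groupCohomology.mem_cocycles₂_iff (A := unitsRep G R) c.1).1 c.2 g h k)

/-- The twisted group algebra `R^c G`: the free `R`-module with basis `(e_g)_{g ∈ G}` and the
`R`-bilinear multiplication determined by `e_g e_h = c(g, h) e_{gh}`. -/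
def TwistedGroupAlgebra {G R : Type} [Group G] [CommRing R] (_c : TwoCocycle G R) : Type :=
  G →₀ R

namespace TwistedGroupAlgebra

variable {G R : Type} [Group G] [CommRing R] (c : TwoCocycle G R)

instance : AddCommGroup (TwistedGroupAlgebra c) :=
  inferInstanceAs (AddCommGroup (G →₀ R))

instance : Module R (TwistedGroupAlgebra c) :=
  inferInstanceAs (Module R (G →₀ R))

/-- The basis `(e_g)_{g ∈ G}` of `R^c G`. -/
def basis : Module.Basis G R (TwistedGroupAlgebra c) :=
  ⟨LinearEquiv.refl R (G →₀ R)⟩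

/-- The bilinear multiplication of `R^c G`, given on the basis by `e_g e_h = c(g, h) e_{gh}`. -/
def mulLin :
    TwistedGroupAlgebra c →ₗ[R] TwistedGroupAlgebra c →ₗ[R] TwistedGroupAlgebra c :=
  (basis c).constr R fun g => (basis c).constr R fun h => (c.val g h : R) • basis c (g * h)

instance : Mul (TwistedGroupAlgebra c) := ⟨fun a b => mulLin c a b⟩

/-- The identity element is `c(1, 1)⁻¹ e_1`. -/
instance : One (TwistedGroupAlgebra c) := ⟨(((c.val 1 1)⁻¹ : Rˣ) : R) • basis c 1⟩

theorem mul_def (a b : TwistedGroupAlgebra c) : a * b = mulLin c a b := rfl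

theorem one_def : (1 : TwistedGroupAlgebra c) = (((c.val 1 1)⁻¹ : Rˣ) : R) • basis c 1 := rfl

theorem basis_mul_basis (g h : G) :
    basis c g * basis c h = (c.val g h : R) • basis c (g * h) := by
  simp [mul_def, mulLin, Module.Basis.constr_basis]

theorem induction_basis {P : TwistedGroupAlgebra c → Prop} (x : TwistedGroupAlgebra c)
    (hb : ∀ g, P (basis c g)) (h0 : P 0) (hadd : ∀ x y, P x → P y → P (x + y))
    (hsmul : ∀ (r : R) x, P x → P (r • x)) : P x := by
  refine Submodule.span_induction (p := fun x _ => P x) ?_ h0 (fun x y _ _ => hadd x y)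
    (fun r x _ => hsmul r x) ((basis c).mem_span x)
  rintro _ ⟨g, rfl⟩
  exact hb g

theorem mulLin_basis (g h : G) :
    mulLin c (basis c g) (basis c h) = (c.val g h : R) • basis c (g * h) :=
  basis_mul_basis c g h

theorem mulLin_assoc (x y z : TwistedGroupAlgebra c) :
    mulLin c (mulLin c x y) z = mulLin c x (mulLin c y z) := by
  induction x using induction_basis with
  | h0 => simp
  | hadd a b ha hb => simp [ha, hb]
  | hsmul r a ha => simp [ha]
  | hb g =>
  induction y using induction_basis with
  | h0 => simp
  | hadd a b ha hb => simp [ha, hb]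
  | hsmul r a ha => simp [ha]
  | hb h =>
  induction z using induction_basis with
  | h0 => simp
  | hadd a b ha hb => simp [ha, hb]
  | hsmul r a ha => simp [ha]
  | hb k =>
  have := congrArg (Units.val) (c.val_assoc g h k)
  simp only [Units.val_mul] at this
  simp only [mulLin_basis, map_smul, LinearMap.smul_apply, smul_smul, mul_assoc g h k]
  rw [mul_comm, this]

theorem one_mulLin (x : TwistedGroupAlgebra c) : mulLin c 1 x = x := by
  induction x using induction_basis with
  | h0 => simp
  | hadd a b ha hb => simp [ha, hb]
  | hsmul r a ha => simp [ha]
  | hb g =>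
  have h : c.val 1 g = c.val 1 1 := by
    simpa using (c.val_assoc 1 1 g).symm
  simp [one_def, mulLin_basis, smul_smul, h]

theorem mulLin_one (x : TwistedGroupAlgebra c) : mulLin c x 1 = x := by
  induction x using induction_basis with
  | h0 => simp
  | hadd a b ha hb => simp [ha, hb]
  | hsmul r a ha => simp [ha]
  | hb g =>
  have h : c.val g 1 = c.val 1 1 := by
    simpa using c.val_assoc g 1 1
  simp [one_def, mulLin_basis, smul_smul, h]

instance : Ring (TwistedGroupAlgebra c) :=
  { (inferInstance : AddCommGroup (TwistedGroupAlgebra c)) with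
    mul := (· * ·)
    one := 1
    mul_assoc := mulLin_assoc c
    one_mul := one_mulLin c
    mul_one := mulLin_one c
    left_distrib := fun a b d => map_add (mulLin c a) b d
    right_distrib := fun a b d => LinearMap.map_add₂ (mulLin c) a b d
    zero_mul := fun a => LinearMap.map_zero₂ (mulLin c) a
    mul_zero := fun a => map_zero (mulLin c a) }

instance : Algebra R (TwistedGroupAlgebra c) :=
  Algebra.ofModule (fun r a b => LinearMap.map_smul₂ (mulLin c) r a b)
    (fun r a b => map_smul (mulLin c a) r b)

end TwistedGroupAlgebra

/-- `G ∼_R H`: there is a group isomorphism `ψ : H²(G, Rˣ) ≃ H²(H, Rˣ)` such that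
`R^c G ≅ R^d H` as `R`-algebras whenever `ψ [c] = [d]`. -/
def TwistIsomorphic (R G H : Type) [CommRing R] [Group G] [Group H] : Prop :=
  ∃ ψ : SchurH2 G R ≃+ SchurH2 H R, ∀ (c : TwoCocycle G R) (d : TwoCocycle H R),
    ψ c.cls = d.cls → Nonempty (TwistedGroupAlgebra c ≃ₐ[R] TwistedGroupAlgebra d)

/-- Generators `α`, `α₁`, `α₂`. -/
inductive Phi2Gen : Type
  | a
  | a₁
  | a₂

open FreeGroup Phi2Gen commutatorElement in
/-- The relations `[α₁, α] = α₂`, `[α, α₂] = [α₁, α₂] = 1`, `α^m = α₁^p = α₂^p = 1`. In the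
presentations of `p`-groups by generators and relations used here, commutators of generators that
are not listed are understood to be trivial; this is spelled out as the centrality of `α₂`. -/
def phi2Rels (p m : ℕ) : Set (FreeGroup Phi2Gen) :=
  {⁅of a₁, of a⁆ * (of a₂)⁻¹, ⁅of a, of a₂⁆, ⁅of a₁, of a₂⁆, of a ^ m, of a₁ ^ p, of a₂ ^ p}

/-- `ES_p(p³)`, for odd `p` the extraspecial group of order `p³` and exponent `p`:
`⟨α, α₁, α₂ ∣ [α₁, α] = α₂, α^p = α₁^p = α₂^p = 1, α₂ central⟩`. -/
abbrev ES (p : ℕ) : Type := PresentedGroup (phi2Rels p p)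

/-- `φ₂(211)c = ⟨α, α₁, α₂ ∣ [α₁, α] = α₂, α^(p²) = α₁^p = α₂^p = 1, α₂ central⟩`. -/
abbrev Phi2_211c (p : ℕ) : Type := PresentedGroup (phi2Rels p (p ^ 2))

/-- `H₁ = φ₂(2111)d = ES_p(p³) × C_{p²}`. -/
abbrev Phi2_2111d (p : ℕ) : Type := ES p × Multiplicative (ZMod (p ^ 2))

/-- `H₂ = φ₂(2111)c = φ₂(211)c × C_p`. -/
abbrev Phi2_2111c (p : ℕ) : Type := Phi2_211c p × Multiplicative (ZMod p)

end

/-!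
The groups `ES n × C_m` and `φ × C_n`, where `φ = ⟨α, α₁, α₂ ∣ phi2Rels n m⟩`, are both central
extensions of `Q = ES n × C_n`, with kernels generated by the `n`-th power of a generator of `C_m`
and by `α ^ n` respectively. Since `n` is odd, commutator calculus shows that both generators lift
to central elements of every central extension by `Kˣ`, so that every 2-cocycle is cohomologous to
one inflated from `Q`. A homomorphism to `C_m` is injective on either kernel, so every character of
the kernel extends to the group, and therefore inflation is also injective on `H²`. Finally, the
twisted group algebra of an inflated cocycle is a product of copies of the twisted group algebra of
`Q`, one for each character of the kernel, and the two kernels have the same order.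
-/

noncomputable section

open commutatorElement

namespace TwoCocycle

variable {G Q R : Type} [Group G] [Group Q] [CommRing R]

/-- The 2-cocycle with prescribed values. -/
def ofVal (f : G → G → Rˣ)
    (hf : ∀ g h k, f (g * h) k * f g h = f h k * f g (h * k)) : TwoCocycle G R :=
  ⟨fun x => Additive.ofMul (f x.1 x.2),
    (groupCohomology.mem_cocycles₂_iff (A := unitsRep G R) _).2 fun g h k =>
      congrArg Additive.ofMul (hf g h k)⟩

theorem val_one_left (c : TwoCocycle G R) (g : G) : c.val 1 g = c.val 1 1 := by
  simpa using (c.val_assoc 1 1 g).symm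

theorem val_one_right (c : TwoCocycle G R) (g : G) : c.val g 1 = c.val 1 1 := by
  simpa using c.val_assoc g 1 1

theorem cls_surjective : Function.Surjective (cls : TwoCocycle G R → SchurH2 G R) := fun x =>
  groupCohomology.H2_induction_on x fun c => ⟨c, rfl⟩

theorem cls_eq_zero_iff (c : TwoCocycle G R) :
    c.cls = 0 ↔ ∃ β : G → Rˣ, ∀ g h, c.val g h * β (g * h) = β g * β h := by
  have coboundary_iff (β : G → Additive Rˣ) (g h : G) :
      β h - β (g * h) + β g = c.1 (g, h) ↔ c.1 (g, h) + β (g * h) = β g + β h := by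
    rw [sub_add_eq_add_sub, sub_eq_iff_eq_add, add_comm (β h), eq_comm]
  refine (groupCohomology.H2π_eq_zero_iff c).trans ⟨?_, ?_⟩
  · rintro ⟨β, hβ⟩
    exact ⟨fun g => Additive.toMul (β g), fun g h =>
      congrArg Additive.toMul ((coboundary_iff β g h).1 (congrFun hβ (g, h)))⟩
  · rintro ⟨β, hβ⟩
    exact ⟨fun g => Additive.ofMul (β g), funext fun ⟨g, h⟩ =>
      (coboundary_iff _ g h).2 (congrArg Additive.ofMul (hβ g h))⟩

theorem cls_eq_iff (c d : TwoCocycle G R) :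
    c.cls = d.cls ↔ ∃ β : G → Rˣ, ∀ g h, c.val g h * β (g * h) = β g * β h * d.val g h := by
  have val_sub (g h : G) : (c - d).val g h = c.val g h / d.val g h := rfl
  have cls_sub : (c - d).cls = c.cls - d.cls :=
    map_sub (groupCohomology.H2π (unitsRep G R)).hom c d
  rw [← sub_eq_zero, ← cls_sub, cls_eq_zero_iff]
  simp only [val_sub, div_mul_eq_mul_div, div_eq_iff_eq_mul]

/-- The pullback of a 2-cocycle along a group homomorphism. -/
def comap (π : G →* Q) (a : TwoCocycle Q R) : TwoCocycle G R :=
  ofVal (fun g h => a.val (π g) (π h)) fun g h k => by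
    simpa only [map_mul] using a.val_assoc (π g) (π h) (π k)

@[simp]
theorem comap_val (π : G →* Q) (a : TwoCocycle Q R) (g h : G) :
    (comap π a).val g h = a.val (π g) (π h) := rfl

end TwoCocycle

/-- The inflation map `H²(Q, Rˣ) → H²(G, Rˣ)` along a group homomorphism `π : G → Q`. -/
def inflation (R : Type) [CommRing R] {G Q : Type} [Group G] [Group Q] (π : G →* Q) :
    SchurH2 Q R →+ SchurH2 G R :=
  (groupCohomology.map (A := unitsRep Q R) (B := unitsRep G R) π
    (CategoryTheory.CategoryStruct.id _) 2).hom.toAddMonoidHom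

theorem inflation_cls {R G Q : Type} [CommRing R] [Group G] [Group Q] (π : G →* Q)
    (a : TwoCocycle Q R) : inflation R π a.cls = (a.comap π).cls :=
  groupCohomology.H2π_comp_map_apply (A := unitsRep Q R) (B := unitsRep G R) π
    (CategoryTheory.CategoryStruct.id _) a

namespace TwistedGroupAlgebra

variable {G R : Type} [Group G] [CommRing R]

theorem basis_one (c : TwoCocycle G R) : basis c 1 = (c.val 1 1 : R) • 1 := by
  rw [one_def, smul_smul, Units.mul_inv, one_smul]

/-- The universal property of `R^c G`: the algebra homomorphism sending `e_g` to `f g`. -/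
def lift (c : TwoCocycle G R) {A : Type*} [Ring A] [Algebra R A] (f : G → A)
    (map_one : f 1 = (c.val 1 1 : R) • (1 : A))
    (map_mul : ∀ g h, f g * f h = (c.val g h : R) • f (g * h)) :
    TwistedGroupAlgebra c →ₐ[R] A :=
  AlgHom.ofLinearMap ((basis c).constr R f)
    (by rw [one_def, map_smul, Module.Basis.constr_basis, map_one, smul_smul, Units.inv_mul,
      one_smul])
    (by
      intro x y
      induction x using induction_basis with
      | h0 => simp
      | hadd a b ha hb => simp [add_mul, ha, hb]
      | hsmul r a ha => simp [ha]
      | hb g =>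
      induction y using induction_basis with
      | h0 => simp
      | hadd a b ha hb => simp [mul_add, ha, hb]
      | hsmul r a ha => simp [ha]
      | hb h => rw [basis_mul_basis, map_smul, Module.Basis.constr_basis,
          Module.Basis.constr_basis, Module.Basis.constr_basis, map_mul])

@[simp]
theorem lift_basis (c : TwoCocycle G R) {A : Type*} [Ring A] [Algebra R A] (f : G → A)
    (map_one : f 1 = (c.val 1 1 : R) • (1 : A))
    (map_mul : ∀ g h, f g * f h = (c.val g h : R) • f (g * h)) (g : G) :
    lift c f map_one map_mul (basis c g) = f g :=
  (basis c).constr_basis R f g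

theorem algHom_ext {c : TwoCocycle G R} {A : Type*} [Ring A] [Algebra R A]
    {F F' : TwistedGroupAlgebra c →ₐ[R] A} (h : ∀ g, F (basis c g) = F' (basis c g)) : F = F' :=
  AlgHom.toLinearMap_injective ((basis c).ext h)

theorem exists_algHom_of_cohomologous {c d : TwoCocycle G R} {β : G → Rˣ}
    (hβ : ∀ g h, c.val g h * β (g * h) = β g * β h * d.val g h) :
    ∃ F : TwistedGroupAlgebra c →ₐ[R] TwistedGroupAlgebra d,
      ∀ g, F (basis c g) = (β g : R) • basis d g := by
  have val_one_one : c.val 1 1 = β 1 * d.val 1 1 :=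
    mul_right_cancel (b := β 1) <| by simpa only [mul_one, mul_right_comm] using hβ 1 1
  refine ⟨lift c (fun g => (β g : R) • basis d g) ?_ fun g h => ?_, fun g => lift_basis ..⟩
  · rw [basis_one, smul_smul, val_one_one, Units.val_mul]
  · rw [smul_mul_smul_comm, basis_mul_basis, smul_smul, smul_smul]
    exact_mod_cast congrArg (fun u : Rˣ => (u : R) • basis d (g * h)) (hβ g h).symm

theorem nonempty_algEquiv_of_cls_eq {c d : TwoCocycle G R} (h : c.cls = d.cls) :
    Nonempty (TwistedGroupAlgebra c ≃ₐ[R] TwistedGroupAlgebra d) := by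
  obtain ⟨β, hβ⟩ := (TwoCocycle.cls_eq_iff c d).1 h
  have hβ' (g h : G) : d.val g h * (β (g * h))⁻¹ = (β g)⁻¹ * (β h)⁻¹ * c.val g h := by
    rw [mul_inv_eq_iff_eq_mul, mul_assoc, hβ, ← mul_inv, inv_mul_cancel_left]
  obtain ⟨F, hF⟩ := exists_algHom_of_cohomologous hβ
  obtain ⟨F', hF'⟩ := exists_algHom_of_cohomologous (β := fun g => (β g)⁻¹) hβ'
  exact ⟨AlgEquiv.ofAlgHom F F' (algHom_ext fun g => by simp [hF, hF', smul_smul])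
    (algHom_ext fun g => by simp [hF, hF', smul_smul])⟩

end TwistedGroupAlgebra

section CommutatorPowers

variable {Γ : Type*} [Group Γ] {x y : Γ} {n : ℕ}

theorem commutatorElement_pow_left (h : Commute ⁅x, y⁆ x) (n : ℕ) : ⁅x ^ n, y⁆ = ⁅x, y⁆ ^ n := by
  induction n with
  | zero => rw [pow_zero, pow_zero, commutatorElement_one_left]
  | succ n ih =>
    rw [pow_succ', commutatorElement_mul_left_eq_conj_mul, ih,
      (h.pow_left n).symm.mul_inv_cancel, pow_succ]

theorem commutatorElement_pow_right (h : Commute ⁅x, y⁆ y) (n : ℕ) : ⁅x, y ^ n⁆ = ⁅x, y⁆ ^ n := by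
  rw [← commutatorElement_inv y x, Commute.inv_left_iff] at h
  rw [← commutatorElement_inv, commutatorElement_pow_left h, ← inv_pow, commutatorElement_inv]

theorem mul_pow_eq_mul_commutatorElement_pow (hx : Commute ⁅y, x⁆ x) (hy : Commute ⁅y, x⁆ y)
    (n : ℕ) : (x * y) ^ n = x ^ n * y ^ n * ⁅y, x⁆ ^ n.choose 2 := by
  induction n with
  | zero => simp
  | succ n ih =>
    have swap : y ^ n * x = x * y ^ n * ⁅y, x⁆ ^ n := by
      rw [(hy.pow_pow n n).symm.right_comm, ← (hx.pow_left n).eq, ← commutatorElement_pow_left hy,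
        commutatorElement_def]
      group
    have choose_succ : (n + 1).choose 2 = n + n.choose 2 := by
      rw [Nat.choose_succ_succ' n 1, Nat.choose_one_right]
    have hxy : Commute (⁅y, x⁆ ^ n.choose 2) (x * y) := (hx.mul_right hy).pow_left _
    calc (x * y) ^ (n + 1) = x ^ n * (y ^ n * x) * y * ⁅y, x⁆ ^ n.choose 2 := by
          rw [pow_succ, ih, mul_assoc _ _ (x * y), hxy.eq]; simp only [mul_assoc]
      _ = x ^ (n + 1) * y ^ n * (⁅y, x⁆ ^ n * y) * ⁅y, x⁆ ^ n.choose 2 := by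
          rw [swap, pow_succ]; simp only [mul_assoc]
      _ = x ^ (n + 1) * y ^ (n + 1) * ⁅y, x⁆ ^ (n + 1).choose 2 := by
          rw [(hy.pow_left n).eq, choose_succ, pow_add ⁅y, x⁆, pow_succ y]; simp only [mul_assoc]

theorem mul_pow_of_odd (hx : Commute ⁅y, x⁆ x) (hy : Commute ⁅y, x⁆ y) (hn : Odd n)
    (h : ⁅y, x⁆ ^ n = 1) : (x * y) ^ n = x ^ n * y ^ n := by
  obtain ⟨k, hk⟩ : n ∣ n.choose 2 := by
    obtain ⟨k, rfl⟩ := hn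
    rw [Nat.choose_two_right, Nat.add_sub_cancel, mul_left_comm,
      Nat.mul_div_cancel_left _ two_pos]
    exact dvd_mul_right _ _
  rw [mul_pow_eq_mul_commutatorElement_pow hx hy, hk, pow_mul, h, one_pow, mul_one]

theorem commutatorElement_pow_right_of_odd (hcen : ⁅y, ⁅x, y⁆⁆ ∈ Subgroup.center Γ) (hn : Odd n)
    (hpow : Commute (⁅x, y⁆ ^ n) y) : ⁅x, y ^ n⁆ = ⁅x, y⁆ ^ n := by
  have hcomm (z : Γ) : Commute ⁅y, ⁅x, y⁆⁆ z := (Subgroup.mem_center_iff.1 hcen z).symm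
  have htorsion : ⁅y, ⁅x, y⁆⁆ ^ n = 1 := by
    rw [← commutatorElement_pow_right (hcomm _), commutatorElement_eq_one_iff_commute]
    exact hpow.symm
  have hconj : x * y * x⁻¹ = ⁅x, y⁆ * y := by rw [commutatorElement_def, inv_mul_cancel_right]
  -- `x` conjugates `y ^ n` to `(⁅x, y⁆ * y) ^ n`; for odd `n` the class two correction vanishes.
  rw [commutatorElement_def x (y ^ n), ← conj_pow, hconj,
    mul_pow_of_odd (hcomm _) (hcomm _) hn htorsion, mul_inv_cancel_right]

theorem commute_pow_left_of_odd (hx : ⁅x, ⁅y, x⁆⁆ ∈ Subgroup.center Γ)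
    (hy : ⁅y, ⁅x, y⁆⁆ ∈ Subgroup.center Γ) (hn : Odd n) (hcomm : ⁅x, y⁆ ^ n ∈ Subgroup.center Γ)
    (hpow : y ^ n ∈ Subgroup.center Γ) : Commute (x ^ n) y := by
  have hinv : ⁅y, x⁆ ^ n = (⁅x, y⁆ ^ n)⁻¹ := by rw [← inv_pow, commutatorElement_inv]
  have hone : ⁅x, y⁆ ^ n = 1 := by
    rw [← commutatorElement_pow_right_of_odd hy hn (Subgroup.mem_center_iff.1 hcomm y).symm,
      commutatorElement_eq_one_iff_commute]
    exact Subgroup.mem_center_iff.1 hpow x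
  rw [← commutatorElement_eq_one_iff_commute, ← commutatorElement_inv, inv_eq_one,
    commutatorElement_pow_right_of_odd hx hn, hinv, hone, inv_one]
  rw [hinv, hone, inv_one]
  exact Commute.one_left x

end CommutatorPowers

/-- The extension of `G` by `Rˣ` defined by a 2-cocycle `c`: pairs `(u, g)` multiplied by
`(u, g) (v, h) = (u v c(g, h), g h)`. As `c` need not be normalized, its identity element is
`(c(1, 1)⁻¹, 1)`. -/
@[ext]
structure CocycleExtension {G R : Type} [Group G] [CommRing R] (c : TwoCocycle G R) : Type where
  coeff : Rˣ
  base : G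

namespace CocycleExtension

variable {G R : Type} [Group G] [CommRing R] (c : TwoCocycle G R)

instance : Mul (CocycleExtension c) :=
  ⟨fun x y => ⟨x.coeff * y.coeff * c.val x.base y.base, x.base * y.base⟩⟩

instance : One (CocycleExtension c) := ⟨⟨(c.val 1 1)⁻¹, 1⟩⟩

instance : Inv (CocycleExtension c) :=
  ⟨fun x => ⟨(c.val 1 1)⁻¹ * (c.val x.base⁻¹ x.base)⁻¹ * x.coeff⁻¹, x.base⁻¹⟩⟩

theorem mul_coeff (x y : CocycleExtension c) :
    (x * y).coeff = x.coeff * y.coeff * c.val x.base y.base := rfl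

theorem mul_base (x y : CocycleExtension c) : (x * y).base = x.base * y.base := rfl

theorem one_coeff : (1 : CocycleExtension c).coeff = (c.val 1 1)⁻¹ := rfl

theorem one_base : (1 : CocycleExtension c).base = 1 := rfl

theorem inv_coeff (x : CocycleExtension c) :
    x⁻¹.coeff = (c.val 1 1)⁻¹ * (c.val x.base⁻¹ x.base)⁻¹ * x.coeff⁻¹ := rfl

theorem inv_base (x : CocycleExtension c) : x⁻¹.base = x.base⁻¹ := rfl

instance : Group (CocycleExtension c) :=
  Group.ofLeftAxioms
    (fun x y z => by
      ext1
      · simp only [mul_coeff, mul_base]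
        calc _ = x.coeff * y.coeff * z.coeff *
              (c.val (x.base * y.base) z.base * c.val x.base y.base) := by ac_rfl
          _ = x.coeff * y.coeff * z.coeff *
              (c.val y.base z.base * c.val x.base (y.base * z.base)) := by rw [c.val_assoc]
          _ = _ := by ac_rfl
      · exact mul_assoc _ _ _)
    (fun x => by
      ext1
      · rw [mul_coeff, one_coeff, one_base, c.val_one_left x.base, mul_right_comm, inv_mul_cancel,
          one_mul]
      · exact one_mul _)
    (fun x => by
      ext1
      · rw [mul_coeff, inv_coeff, inv_base, inv_mul_cancel_right, inv_mul_cancel_right, one_coeff]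
      · exact inv_mul_cancel _)

/-- The projection of the extension onto `G`. -/
def proj : CocycleExtension c →* G where
  toFun := base
  map_one' := rfl
  map_mul' _ _ := rfl

@[simp]
theorem proj_apply (x : CocycleExtension c) : proj c x = x.base := rfl

/-- The inclusion of `Rˣ` in the extension. -/
def incl : Rˣ →* CocycleExtension c where
  toFun u := ⟨u * (c.val 1 1)⁻¹, 1⟩
  map_one' := by rw [one_mul]; rfl
  map_mul' u v := by
    ext1
    · rw [mul_coeff, ← mul_assoc, inv_mul_cancel_right, mul_right_comm]
    · exact (one_mul _).symm

theorem incl_injective : Function.Injective (incl c) := fun _ _ h =>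
  mul_right_cancel (congrArg coeff h)

theorem incl_mul (u : Rˣ) (x : CocycleExtension c) : incl c u * x = ⟨u * x.coeff, x.base⟩ := by
  ext1
  · change u * (c.val 1 1)⁻¹ * x.coeff * c.val 1 x.base = u * x.coeff
    rw [c.val_one_left x.base, mul_right_comm, inv_mul_cancel_right]
  · exact one_mul _

theorem mul_incl (u : Rˣ) (x : CocycleExtension c) : x * incl c u = ⟨u * x.coeff, x.base⟩ := by
  ext1
  · change x.coeff * (u * (c.val 1 1)⁻¹) * c.val x.base 1 = u * x.coeff
    rw [c.val_one_right x.base, ← mul_assoc, inv_mul_cancel_right, mul_comm]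
  · exact mul_one _

variable {c}

theorem commute_incl (u : Rˣ) (x : CocycleExtension c) : Commute (incl c u) x :=
  (incl_mul c u x).trans (mul_incl c u x).symm

theorem exists_incl_mul_eq {x y : CocycleExtension c} (h : x.base = y.base) :
    ∃ u, incl c u * x = y :=
  ⟨y.coeff * x.coeff⁻¹, by rw [incl_mul, inv_mul_cancel_right, h]⟩

theorem exists_incl_eq {x : CocycleExtension c} (h : x.base = 1) : ∃ u, incl c u = x := by
  simpa only [mul_one] using exists_incl_mul_eq (x := 1) h.symm

theorem ker_proj_le_center : (proj c).ker ≤ Subgroup.center (CocycleExtension c) := fun x hx => by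
  obtain ⟨u, rfl⟩ := exists_incl_eq hx
  exact Subgroup.mem_center_iff.2 fun y => (commute_incl u y).symm

theorem commutatorElement_mem_center {x y : CocycleExtension c} (h : Commute x.base y.base) :
    ⁅x, y⁆ ∈ Subgroup.center (CocycleExtension c) :=
  ker_proj_le_center <| by
    rw [MonoidHom.mem_ker, map_commutatorElement, commutatorElement_eq_one_iff_commute]
    exact h

theorem pow_mem_center {x : CocycleExtension c} {n : ℕ} (h : x.base ^ n = 1) :
    x ^ n ∈ Subgroup.center (CocycleExtension c) :=
  ker_proj_le_center <| by rwa [MonoidHom.mem_ker, map_pow]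

theorem commute_of_base_eq {x y : CocycleExtension c} (h : x.base = y.base) : Commute x y := by
  obtain ⟨u, rfl⟩ := exists_incl_mul_eq h
  exact (commute_incl u x).symm.mul_right (Commute.refl x)

theorem commute_pow_left_of_odd {x y : CocycleExtension c} {n : ℕ} (hn : Odd n)
    (hx : Commute x.base ⁅x.base, y.base⁆) (hy : Commute y.base ⁅x.base, y.base⁆)
    (hpow : y.base ^ n = 1) : Commute (x ^ n) y := by
  have base_commutator : ⁅x, y⁆.base = ⁅x.base, y.base⁆ := map_commutatorElement (proj c) x y
  have base_commutator' : ⁅y, x⁆.base = ⁅x.base, y.base⁆⁻¹ := by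
    rw [commutatorElement_inv]; exact map_commutatorElement (proj c) y x
  refine _root_.commute_pow_left_of_odd (commutatorElement_mem_center ?_)
    (commutatorElement_mem_center ?_) hn (pow_mem_center ?_) (pow_mem_center hpow)
  · rw [base_commutator']; exact hx.inv_right
  · rwa [base_commutator]
  · rw [base_commutator, ← commutatorElement_pow_right hy.symm, hpow, commutatorElement_one_right]

end CocycleExtension

/-- The elements of `G` that lift to a central element of the extension of `G` by `Rˣ` defined by
any 2-cocycle. For `R = ℂ` this is the epicentre of Beyl, Felgner and Schmid. -/
def epicentre (R G : Type) [CommRing R] [Group G] : Subgroup G :=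
  ⨅ c : TwoCocycle G R, (Subgroup.center (CocycleExtension c)).map (CocycleExtension.proj c)

section Epicentre

variable {R G : Type} [CommRing R] [Group G]

theorem mem_epicentre_iff {g : G} : g ∈ epicentre R G ↔
    ∀ c : TwoCocycle G R, ∃ x ∈ Subgroup.center (CocycleExtension c), x.base = g :=
  Subgroup.mem_iInf

theorem mem_epicentre_of_closure_eq_top {S : Set G} (hS : Subgroup.closure S = ⊤) {g : G}
    (h : ∀ c : TwoCocycle G R, ∃ x : CocycleExtension c, x.base = g ∧
      ∀ y : CocycleExtension c, y.base ∈ S → Commute x y) : g ∈ epicentre R G := by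
  refine mem_epicentre_iff.2 fun c => ?_
  obtain ⟨x, rfl, hx⟩ := h c
  have map_eq_top : (Subgroup.centralizer {x}).map (CocycleExtension.proj c) = ⊤ := by
    rw [← top_le_iff, ← hS, Subgroup.closure_le]
    exact fun s hs => ⟨⟨1, s⟩, Subgroup.mem_centralizer_singleton_iff.2 (hx ⟨1, s⟩ hs).symm, rfl⟩
  have centralizer_eq_top : Subgroup.centralizer {x} = ⊤ := by
    rw [← Subgroup.comap_map_eq_self (CocycleExtension.ker_proj_le_center.trans
      (Subgroup.center_le_centralizer _)), map_eq_top, Subgroup.comap_top]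
  refine ⟨x, Subgroup.mem_center_iff.2 fun y => ?_, rfl⟩
  exact Subgroup.mem_centralizer_singleton_iff.1 (centralizer_eq_top ▸ Subgroup.mem_top y)

theorem pow_mem_epicentre {n : ℕ} (hn : Odd n) {S : Set G} (hS : Subgroup.closure S = ⊤) {g : G}
    (h : ∀ s ∈ S, s ≠ g → Commute g ⁅g, s⁆ ∧ Commute s ⁅g, s⁆ ∧ s ^ n = 1) :
    g ^ n ∈ epicentre R G := by
  refine mem_epicentre_of_closure_eq_top hS fun c => ?_
  let x : CocycleExtension c := ⟨1, g⟩
  refine ⟨x ^ n, map_pow (CocycleExtension.proj c) x n, fun y hy => ?_⟩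
  rcases eq_or_ne y.base g with hyg | hyg
  · exact (CocycleExtension.commute_of_base_eq hyg.symm).pow_left n
  · obtain ⟨hg, hs, hpow⟩ := h _ hy hyg
    exact CocycleExtension.commute_pow_left_of_odd hn hg hs hpow

end Epicentre

section Extension

variable {N G Q R : Type} [Group N] [Group G] [Group Q] [CommRing R] (S : GroupExtension N G Q)

theorem exists_eq_mul_inl {g h : G} (hgh : S.rightHom g = S.rightHom h) :
    ∃ m, g = h * S.inl m := by
  have hmem : h⁻¹ * g ∈ S.inl.range := by
    rw [S.range_inl_eq_ker_rightHom, MonoidHom.mem_ker, map_mul, map_inv, hgh, inv_mul_cancel]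
  obtain ⟨m, hm⟩ := hmem
  exact ⟨m, by rw [hm, mul_inv_cancel_left]⟩

theorem rightHom_mul_inl (g : G) (m : N) : S.rightHom (g * S.inl m) = S.rightHom g := by
  rw [map_mul, S.rightHom_inl, mul_one]

theorem exists_apply_rightHom_eq {X : Type*} {f : G → X} (hf : ∀ g m, f (g * S.inl m) = f g) :
    ∃ f' : Q → X, ∀ g, f' (S.rightHom g) = f g := by
  refine ⟨fun q => f (Function.surjInv S.rightHom_surjective q), fun g => ?_⟩
  obtain ⟨m, hm⟩ := exists_eq_mul_inl S (Function.surjInv_eq S.rightHom_surjective (S.rightHom g))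
  exact (congrArg f hm).trans (hf g m)

/-- The values of a trivialisation of an inflated cocycle restrict to a character of the kernel;
dividing by an extension of this character makes the trivialisation descend to the quotient. -/
theorem inflation_injective (hS : ∀ φ : N →* Rˣ, ∃ χ : G →* Rˣ, χ.comp S.inl = φ) :
    Function.Injective (inflation R S.rightHom) := by
  refine (injective_iff_map_eq_zero _).2 fun x hx => ?_
  obtain ⟨a, rfl⟩ := TwoCocycle.cls_surjective x
  rw [inflation_cls] at hx
  obtain ⟨β, hβ⟩ := (TwoCocycle.cls_eq_zero_iff _).1 hx
  simp only [TwoCocycle.comap_val] at hβ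
  have beta_one : β 1 = a.val 1 1 := by
    simpa only [map_one, mul_one, mul_left_inj, eq_comm] using hβ 1 1
  have beta_mul_inl (g : G) (m : N) : β (g * S.inl m) = β g * ((β 1)⁻¹ * β (S.inl m)) := by
    have h := hβ g (S.inl m)
    rw [S.rightHom_inl, a.val_one_right, ← beta_one] at h
    rw [mul_left_comm, ← h, inv_mul_cancel_left]
  obtain ⟨χ, hχ⟩ := hS
    { toFun := fun m => (β 1)⁻¹ * β (S.inl m)
      map_one' := by rw [map_one, inv_mul_cancel]
      map_mul' := fun m k => by rw [map_mul, beta_mul_inl, mul_assoc] }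
  obtain ⟨γ, hγ⟩ := exists_apply_rightHom_eq S (f := fun g => β g / χ g) fun g m => by
    have chi_inl : χ (S.inl m) = (β 1)⁻¹ * β (S.inl m) := DFunLike.congr_fun hχ m
    rw [beta_mul_inl, map_mul, chi_inl, mul_div_mul_right_eq_div]
  refine (TwoCocycle.cls_eq_zero_iff a).2 ⟨γ, fun q r => ?_⟩
  obtain ⟨g, rfl⟩ := S.rightHom_surjective q
  obtain ⟨h, rfl⟩ := S.rightHom_surjective r
  rw [← map_mul, hγ, hγ, hγ, map_mul, div_mul_div_comm, ← hβ, mul_div_assoc]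

end Extension

section Surjectivity

open CocycleExtension

variable {N G Q R : Type} [Group N] [Group G] [Group Q] [CommRing R] {c : TwoCocycle G R}

theorem cls_mem_range_inflation_of_factorSet {π : G →* Q} (hπ : Function.Surjective π)
    {w : G → CocycleExtension c} (base_w : ∀ g, (w g).base = g) {f : Q → Q → Rˣ}
    (hf : ∀ g h, w g * w h = incl c (f (π g) (π h)) * w (g * h)) :
    c.cls ∈ Set.range (inflation R π) := by
  have assoc (g h k : G) : f (π (g * h)) (π k) * f (π g) (π h) =
      f (π h) (π k) * f (π g) (π (h * k)) := by
    refine incl_injective c (mul_right_cancel (b := w (g * h * k)) ?_)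
    calc incl c (f (π (g * h)) (π k) * f (π g) (π h)) * w (g * h * k)
        = incl c (f (π g) (π h)) * (w (g * h) * w k) := by
          rw [hf (g * h), ← mul_assoc, ← map_mul, mul_comm]
      _ = w g * (incl c (f (π h) (π k)) * w (h * k)) := by
          rw [← hf, ← mul_assoc, ← hf, mul_assoc]
      _ = incl c (f (π h) (π k) * f (π g) (π (h * k))) * w (g * h * k) := by
          rw [(commute_incl _ (w g)).symm.left_comm, hf g, ← mul_assoc, ← map_mul, mul_assoc g]
  refine ⟨(TwoCocycle.ofVal f fun q r t => ?_).cls, ?_⟩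
  · obtain ⟨g, rfl⟩ := hπ q
    obtain ⟨h, rfl⟩ := hπ r
    obtain ⟨k, rfl⟩ := hπ t
    simpa only [map_mul] using assoc g h k
  · rw [inflation_cls]
    refine (TwoCocycle.cls_eq_iff _ _).2 ⟨fun g => (w g).coeff, fun g h => ?_⟩
    have hcoeff := congrArg coeff (hf g h)
    rw [mul_coeff, base_w, base_w, incl_mul] at hcoeff
    exact hcoeff.symm

variable (S : GroupExtension N G Q) {σ : N →* CocycleExtension c}

theorem exists_equivariant_section (hσ : ∀ m, (σ m).base = S.inl m) :
    ∃ w : G → CocycleExtension c, (∀ g, (w g).base = g) ∧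
      ∀ g m, w (g * S.inl m) = w g * σ m := by
  have hs := Function.surjInv_eq S.rightHom_surjective
  generalize Function.surjInv S.rightHom_surjective = s at hs
  choose k hk using fun g => exists_eq_mul_inl S (hs (S.rightHom g)).symm
  refine ⟨fun g => ⟨1, s (S.rightHom g)⟩ * σ (k g), fun g => ?_, fun g m => ?_⟩
  · rw [mul_base, hσ, ← hk]
  · have k_mul : k (g * S.inl m) = k g * m := by
      refine S.inl_injective (mul_left_cancel (a := s (S.rightHom g)) ?_)
      rw [map_mul, ← mul_assoc, ← hk, ← rightHom_mul_inl S g m, ← hk]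
    simp only [map_mul, S.rightHom_inl, mul_one, k_mul, mul_assoc]

theorem cls_mem_range_inflation (hσ : ∀ m, (σ m).base = S.inl m)
    (hcen : σ.range ≤ Subgroup.center (CocycleExtension c)) :
    c.cls ∈ Set.range (inflation R S.rightHom) := by
  obtain ⟨w, base_w, hw⟩ := exists_equivariant_section S hσ
  choose F hF using fun g h => exists_incl_mul_eq (x := w (g * h)) (y := w g * w h)
    (by rw [mul_base, base_w, base_w, base_w])
  have hcomm (m : N) (x : CocycleExtension c) : Commute (σ m) x :=
    (Subgroup.mem_center_iff.1 (hcen ⟨m, rfl⟩) x).symm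
  have hcomm' (m : N) (g : G) : S.inl m * g = g * S.inl m := by
    simpa only [mul_base, hσ] using congrArg base (hcomm m ⟨1, g⟩).eq
  have F_mul_inl_left (g h : G) (m : N) : F (g * S.inl m) h = F g h := by
    refine incl_injective c (mul_right_cancel (b := w (g * S.inl m * h)) ?_)
    rw [hF, hw, mul_assoc g, hcomm', ← mul_assoc, hw, ← mul_assoc, hF, mul_assoc,
      (hcomm m _).eq, mul_assoc]
  have F_mul_inl_right (g h : G) (m : N) : F g (h * S.inl m) = F g h := by
    refine incl_injective c (mul_right_cancel (b := w (g * (h * S.inl m))) ?_)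
    rw [hF, hw, ← mul_assoc g, hw, ← mul_assoc, ← mul_assoc, hF]
  obtain ⟨F₁, hF₁⟩ := exists_apply_rightHom_eq S (f := F) fun g m =>
    funext fun h => F_mul_inl_left g h m
  choose f hf using fun q => exists_apply_rightHom_eq S (f := F₁ q) fun h m => by
    obtain ⟨g, rfl⟩ := S.rightHom_surjective q
    rw [hF₁, F_mul_inl_right]
  refine cls_mem_range_inflation_of_factorSet S.rightHom_surjective base_w (f := f) fun g h => ?_
  rw [hf, hF₁, hF]

end Surjectivity

section CharacterDecomposition

open TwistedGroupAlgebra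

theorem sum_monoidHom_units_apply {N K : Type*} [CommGroup N] [Fintype N] [Field K]
    [HasEnoughRootsOfUnity K (Monoid.exponent N)] [Fintype (N →* Kˣ)] [DecidableEq N] (m : N) :
    ∑ φ : N →* Kˣ, (φ m : K) = if m = 1 then (Fintype.card N : K) else 0 := by
  split_ifs with hm
  · have card_characters : Fintype.card (N →* Kˣ) = Fintype.card N := by
      simpa only [Nat.card_eq_fintype_card] using
        CommGroup.card_monoidHom_of_hasEnoughRootsOfUnity N K
    simp [hm, card_characters]
  · obtain ⟨φ, hφ⟩ := CommGroup.exists_apply_ne_one_of_hasEnoughRootsOfUnity N K hm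
    exact sum_hom_units_eq_zero ((Units.coeHom K).comp (MonoidHom.eval m)) fun h =>
      hφ (Units.ext (DFunLike.congr_fun h φ))

theorem sum_apply_monoidHom_units {N K : Type*} [Group N] [Fintype N] [Field K]
    [DecidableEq (N →* Kˣ)] (φ : N →* Kˣ) :
    ∑ m, (φ m : K) = if φ = 1 then (Fintype.card N : K) else 0 := by
  split_ifs with hφ
  · simp [hφ]
  · exact sum_hom_units_eq_zero ((Units.coeHom K).comp φ) fun h =>
      hφ (MonoidHom.ext fun m => Units.ext (DFunLike.congr_fun h m))

/-- The homomorphism from the twisted group algebra of an inflated cocycle to a power of the twisted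
group algebra of the quotient whose components send `e_g` to `χ i g • e_{π g}`. -/
def twistedPi {ι G Q R : Type} [Group G] [Group Q] [CommRing R] (π : G →* Q) (χ : ι → G →* Rˣ)
    (a : TwoCocycle Q R) : TwistedGroupAlgebra (a.comap π) →ₐ[R] (ι → TwistedGroupAlgebra a) :=
  lift _ (fun g i => (χ i g : R) • basis a (π g))
    (funext fun i => by
      rw [map_one, map_one, Units.val_one, one_smul, basis_one, TwoCocycle.comap_val, map_one]; rfl)
    (fun g h => funext fun i => by
      simp only [Pi.mul_apply, Pi.smul_apply, smul_mul_smul_comm, basis_mul_basis, smul_smul,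
        map_mul, Units.val_mul, TwoCocycle.comap_val, mul_comm])

theorem twistedPi_basis {ι G Q R : Type} [Group G] [Group Q] [CommRing R] (π : G →* Q)
    (χ : ι → G →* Rˣ) (a : TwoCocycle Q R) (g : G) (i : ι) :
    twistedPi π χ a (basis _ g) i = (χ i g : R) • basis a (π g) :=
  congrFun (lift_basis ..) i

/-- The element `|N|⁻¹ ∑ₘ χ(g m)⁻¹ e_{g m}` of the twisted group algebra of a cocycle inflated from
the quotient by `N`. The image of `e_g` under the projection to the part on which `N` acts through
the restriction of `χ` is `χ(g)` times this element. -/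
def cosetAverage {N G Q K : Type} [Group N] [Group G] [Group Q] [Fintype N] [Field K]
    (S : GroupExtension N G Q) (a : TwoCocycle Q K) (χ : G →* Kˣ) (g : G) :
    TwistedGroupAlgebra (a.comap S.rightHom) :=
  (Fintype.card N : K)⁻¹ • ∑ m, (χ (g * S.inl m) : K)⁻¹ • basis _ (g * S.inl m)

variable {N G Q K : Type} [Fintype N] [Group G] [Group Q] [Field K]

section Group

variable [Group N] (S : GroupExtension N G Q) (a : TwoCocycle Q K)

theorem cosetAverage_mul_inl (χ : G →* Kˣ) (g : G) (m : N) :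
    cosetAverage S a χ (g * S.inl m) = cosetAverage S a χ g := by
  simp only [cosetAverage, mul_assoc, ← map_mul S.inl]
  exact congrArg _ (Equiv.sum_comp (Equiv.mulLeft m)
    fun k => (χ (g * S.inl k) : K)⁻¹ • basis (a.comap S.rightHom) (g * S.inl k))

variable {S a}

theorem twistedPi_cosetAverage [DecidableEq (N →* Kˣ)] [NeZero (Fintype.card N : K)]
    {χ : (N →* Kˣ) → G →* Kˣ} (hχ : ∀ φ m, χ φ (S.inl m) = φ m) (φ : N →* Kˣ) (g : G) :
    twistedPi S.rightHom χ a (cosetAverage S a (χ φ) g) =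
      Pi.single φ (basis a (S.rightHom g)) := by
  have coeff_eq (ψ : N →* Kˣ) (m : N) : (χ φ (g * S.inl m) : K)⁻¹ * χ ψ (g * S.inl m) =
      ((χ φ g : K)⁻¹ * χ ψ g) * ((ψ / φ) m : Kˣ) := by
    rw [map_mul, map_mul, hχ, hχ, MonoidHom.div_apply, Units.val_mul, Units.val_mul,
      Units.val_div_eq_div_val]
    ring
  have sum_coeff (ψ : N →* Kˣ) : ∑ m, (χ φ (g * S.inl m) : K)⁻¹ * χ ψ (g * S.inl m) =
      if ψ = φ then (Fintype.card N : K) else 0 := by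
    simp only [coeff_eq, ← Finset.mul_sum]
    rw [sum_apply_monoidHom_units]
    rcases eq_or_ne ψ φ with rfl | h
    · rw [if_pos (div_self' ψ), if_pos rfl, inv_mul_cancel₀ (Units.ne_zero _), one_mul]
    · rw [if_neg (mt div_eq_one.1 h), if_neg h, mul_zero]
  funext ψ
  simp only [cosetAverage, map_smul, map_sum, Pi.smul_apply, Finset.sum_apply, twistedPi_basis,
    smul_smul, map_mul S.rightHom, S.rightHom_inl, mul_one, ← Finset.sum_smul, sum_coeff,
    Pi.single_apply]
  split_ifs
  · rw [inv_mul_cancel₀ (NeZero.ne _), one_smul]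
  · rw [mul_zero, zero_smul]

end Group

variable [CommGroup N] {S : GroupExtension N G Q} {a : TwoCocycle Q K} {χ : (N →* Kˣ) → G →* Kˣ}

theorem sum_smul_cosetAverage [HasEnoughRootsOfUnity K (Monoid.exponent N)]
    [Fintype (N →* Kˣ)] [NeZero (Fintype.card N : K)] (hχ : ∀ φ m, χ φ (S.inl m) = φ m) (g : G) :
    ∑ φ, (χ φ g : K) • cosetAverage S a (χ φ) g = basis _ g := by
  classical
  have coeff_eq (φ : N →* Kˣ) (m : N) :
      (χ φ g : K) * ((Fintype.card N : K)⁻¹ * (χ φ (g * S.inl m) : K)⁻¹) =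
        (Fintype.card N : K)⁻¹ * φ m⁻¹ := by
    rw [map_mul, hχ, Units.val_mul, mul_inv, mul_left_comm, mul_inv_cancel_left₀ (Units.ne_zero _),
      map_inv, Units.val_inv_eq_inv_val]
  have sum_coeff (m : N) : ∑ φ, (χ φ g : K) * ((Fintype.card N : K)⁻¹ *
      (χ φ (g * S.inl m) : K)⁻¹) = if m = 1 then 1 else 0 := by
    simp only [coeff_eq, ← Finset.mul_sum, sum_monoidHom_units_apply, inv_eq_one, mul_ite, mul_zero,
      inv_mul_cancel₀ (NeZero.ne (Fintype.card N : K))]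
  calc ∑ φ, (χ φ g : K) • cosetAverage S a (χ φ) g
      = ∑ m, (∑ φ, (χ φ g : K) * ((Fintype.card N : K)⁻¹ * (χ φ (g * S.inl m) : K)⁻¹)) •
          basis _ (g * S.inl m) := by
        simp only [cosetAverage, Finset.smul_sum, smul_smul, Finset.sum_smul]
        exact Finset.sum_comm
    _ = basis _ g := by
        simp only [sum_coeff, ite_smul, one_smul, zero_smul]
        rw [Fintype.sum_ite_eq', map_one, mul_one]

theorem twistedPi_bijective [HasEnoughRootsOfUnity K (Monoid.exponent N)]
    [NeZero (Fintype.card N : K)] (hχ : ∀ φ m, χ φ (S.inl m) = φ m) :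
    Function.Bijective (twistedPi S.rightHom χ a) := by
  classical
  have := Fintype.ofFinite (N →* Kˣ)
  constructor
  · obtain ⟨c, hc⟩ : ∃ c : (N →* Kˣ) → Q → TwistedGroupAlgebra (a.comap S.rightHom),
        ∀ φ g, c φ (S.rightHom g) = cosetAverage S a (χ φ) g :=
      Classical.skolem.1 fun φ => exists_apply_rightHom_eq S (cosetAverage_mul_inl S a (χ φ))
    let L : ((N →* Kˣ) → TwistedGroupAlgebra a) →ₗ[K] TwistedGroupAlgebra (a.comap S.rightHom) :=
      ∑ φ, (basis a).constr K (c φ) ∘ₗ LinearMap.proj φ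
    have leftInverse : L ∘ₗ (twistedPi S.rightHom χ a).toLinearMap = LinearMap.id := by
      refine (basis _).ext fun g => ?_
      simp only [L, LinearMap.comp_apply, LinearMap.sum_apply, LinearMap.proj_apply,
        AlgHom.toLinearMap_apply, twistedPi_basis, map_smul, Module.Basis.constr_basis, hc,
        sum_smul_cosetAverage hχ, LinearMap.id_apply]
    exact Function.LeftInverse.injective (DFunLike.congr_fun leftInverse)
  · have single_mem (φ : N →* Kˣ) (y : TwistedGroupAlgebra a) :
        Pi.single φ y ∈ (twistedPi S.rightHom χ a).range := by
      induction y using induction_basis with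
      | h0 => rw [Pi.single_zero]; exact zero_mem _
      | hadd x y hx hy => rw [Pi.single_add]; exact add_mem hx hy
      | hsmul r x hx => rw [Pi.single_smul]; exact Subalgebra.smul_mem _ hx r
      | hb q =>
        obtain ⟨g, rfl⟩ := S.rightHom_surjective q
        exact ⟨_, twistedPi_cosetAverage hχ φ g⟩
    intro y
    rw [← AlgHom.mem_range, ← Finset.univ_sum_single y]
    exact sum_mem fun φ _ => single_mem φ (y φ)

end CharacterDecomposition

section InflationIso

open CocycleExtension TwistedGroupAlgebra

variable {K N G Q : Type} [Field K] [IsSepClosed K] [Group G] [Group Q]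

theorem exists_mem_center_pow_eq_one {c : TwoCocycle G K} {g : G} (hg : g ∈ epicentre K G)
    {n : ℕ} [NeZero (n : K)] (hn : g ^ n = 1) :
    ∃ x ∈ Subgroup.center (CocycleExtension c), x.base = g ∧ x ^ n = 1 := by
  obtain ⟨y, hy, rfl⟩ := mem_epicentre_iff.1 hg c
  obtain ⟨u, hu⟩ := exists_incl_eq (x := y ^ n) ((map_pow (proj c) y n).trans hn)
  have hn₀ : n ≠ 0 := (NeZero.of_neZero_natCast K).out
  obtain ⟨v, hv⟩ := IsSepClosed.exists_pow_nat_eq (u : K) n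
  obtain ⟨v, rfl⟩ := (isUnit_pow_iff hn₀).1 (hv ▸ u.isUnit)
  have hvu : v ^ n = u := Units.ext ((Units.val_pow_eq_pow_val v n).trans hv)
  refine ⟨incl c v⁻¹ * y, mul_mem ?_ hy, ?_, ?_⟩
  · exact Subgroup.mem_center_iff.2 fun x => (commute_incl _ x).symm
  · rw [incl_mul]
  · rw [(commute_incl _ y).mul_pow, ← hu, ← map_pow, ← map_mul, inv_pow, hvu, inv_mul_cancel,
      map_one]

theorem inflation_surjective [Group N] [Finite N] [IsCyclic N] [NeZero (Nat.card N : K)]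
    (S : GroupExtension N G Q) (hS : S.inl.range ≤ epicentre K G) :
    Function.Surjective (inflation K S.rightHom) := by
  intro x
  obtain ⟨c, rfl⟩ := TwoCocycle.cls_surjective x
  obtain ⟨m, hm⟩ := IsCyclic.exists_generator (α := N)
  obtain ⟨x, hx, base_x, x_pow⟩ := exists_mem_center_pow_eq_one (c := c) (hS ⟨m, rfl⟩)
    (n := Nat.card N) (by rw [← map_pow, pow_card_eq_one', map_one])
  let σ : N →* CocycleExtension c := monoidHomOfForallMemZpowers hm (g' := x) <| by
    rw [orderOf_eq_card_of_forall_mem_zpowers hm]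
    exact orderOf_dvd_of_pow_eq_one x_pow
  have σ_zpow (j : ℤ) : σ (m ^ j) = x ^ j := by
    rw [map_zpow, monoidHomOfForallMemZpowers_apply_gen]
  refine cls_mem_range_inflation S (σ := σ) (fun k => ?_) ?_
  · obtain ⟨j, rfl⟩ := hm k
    change proj c (σ (m ^ j)) = S.inl (m ^ j)
    rw [σ_zpow, map_zpow, map_zpow, proj_apply, base_x]
  · rintro _ ⟨k, rfl⟩
    obtain ⟨j, rfl⟩ := hm k
    exact (σ_zpow j).symm ▸ zpow_mem hx j

theorem nonempty_algEquiv_of_inflation_eq [CommGroup N] [Finite N] [NeZero (Nat.card N : K)]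
    (S : GroupExtension N G Q) (hS : ∀ φ : N →* Kˣ, ∃ χ : G →* Kˣ, χ.comp S.inl = φ)
    {c : TwoCocycle G K} {a : TwoCocycle Q K} (h : inflation K S.rightHom a.cls = c.cls) :
    Nonempty (TwistedGroupAlgebra c ≃ₐ[K] ((N →* Kˣ) → TwistedGroupAlgebra a)) := by
  have := Fintype.ofFinite N
  have : NeZero (Fintype.card N : K) := by rwa [← Nat.card_eq_fintype_card]
  have : NeZero (Monoid.exponent N : K) :=
    ⟨ne_zero_of_dvd_ne_zero (NeZero.ne (Nat.card N : K))
      (Nat.cast_dvd_cast Group.exponent_dvd_nat_card)⟩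
  have := IsSepClosed.hasEnoughRootsOfUnity K (Monoid.exponent N)
  choose χ hχ using hS
  rw [inflation_cls] at h
  obtain ⟨e⟩ := nonempty_algEquiv_of_cls_eq h.symm
  exact ⟨e.trans (AlgEquiv.ofBijective (twistedPi S.rightHom χ a)
    (twistedPi_bijective fun φ => DFunLike.congr_fun (hχ φ)))⟩

theorem twistIsomorphic_of_groupExtension [CommGroup N] [Finite N] [IsCyclic N]
    [NeZero (Nat.card N : K)] {H : Type} [Group H]
    (S : GroupExtension N G Q) (T : GroupExtension N H Q)
    (hS : S.inl.range ≤ epicentre K G) (hT : T.inl.range ≤ epicentre K H)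
    (hSχ : ∀ φ : N →* Kˣ, ∃ χ : G →* Kˣ, χ.comp S.inl = φ)
    (hTχ : ∀ φ : N →* Kˣ, ∃ χ : H →* Kˣ, χ.comp T.inl = φ) : TwistIsomorphic K G H := by
  let e := AddEquiv.ofBijective (inflation K S.rightHom)
    ⟨inflation_injective S hSχ, inflation_surjective S hS⟩
  let e' := AddEquiv.ofBijective (inflation K T.rightHom)
    ⟨inflation_injective T hTχ, inflation_surjective T hT⟩
  refine ⟨e.symm.trans e', fun c d hcd => ?_⟩
  obtain ⟨a, ha⟩ := TwoCocycle.cls_surjective (e.symm c.cls)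
  have hc : inflation K S.rightHom a.cls = c.cls := by
    rw [ha]; exact e.apply_symm_apply c.cls
  have hd : inflation K T.rightHom a.cls = d.cls := by
    rw [ha]; exact hcd
  obtain ⟨eG⟩ := nonempty_algEquiv_of_inflation_eq S hSχ hc
  obtain ⟨eH⟩ := nonempty_algEquiv_of_inflation_eq T hTχ hd
  exact ⟨eG.trans eH.symm⟩

theorem exists_extension_of_injective_comp [Group N] (S : GroupExtension N G Q)
    {A : Type*} [CommGroup A] [Finite A] [NeZero (Nat.card A : K)] {θ : G →* A}
    (hθ : Function.Injective (θ.comp S.inl)) (φ : N →* Kˣ) : ∃ χ : G →* Kˣ, χ.comp S.inl = φ := by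
  have : NeZero (Monoid.exponent A : K) :=
    ⟨ne_zero_of_dvd_ne_zero (NeZero.ne (Nat.card A : K))
      (Nat.cast_dvd_cast Group.exponent_dvd_nat_card)⟩
  have := IsSepClosed.hasEnoughRootsOfUnity K (Monoid.exponent A)
  obtain ⟨χ, hχ⟩ := MonoidHom.domRestrict_surjective K (θ.comp S.inl).range
    (φ.comp (MonoidHom.ofInjective hθ).symm.toMonoidHom)
  refine ⟨χ.comp θ, MonoidHom.ext fun m => ?_⟩
  exact (DFunLike.congr_fun hχ (MonoidHom.ofInjective hθ m)).trans
    (congrArg φ ((MonoidHom.ofInjective hθ).symm_apply_apply m))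

end InflationIso

section CyclicKernel

variable {G H Q : Type} [Group G] [Group H] [Group Q]

theorem exists_groupExtension_of_ker_eq_zpowers {N : Type} [Group N] [IsCyclic N]
    {π : G →* Q} (hπ : Function.Surjective π) {z : G} (hker : π.ker = Subgroup.zpowers z)
    (hz : orderOf z = Nat.card N) :
    ∃ S : GroupExtension N G Q, S.inl.range = Subgroup.zpowers z := by
  let e : N ≃* Subgroup.zpowers z :=
    mulEquivOfCyclicCardEq (by rw [Nat.card_zpowers, hz])
  have range_eq : ((Subgroup.zpowers z).subtype.comp e.toMonoidHom).range = Subgroup.zpowers z := by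
    rw [MonoidHom.range_comp, MonoidHom.range_eq_top.2 e.surjective, ← MonoidHom.range_eq_map,
      Subgroup.range_subtype]
  exact ⟨{
    inl := (Subgroup.zpowers z).subtype.comp e.toMonoidHom
    rightHom := π
    inl_injective := Subtype.val_injective.comp e.injective
    range_inl_eq_ker_rightHom := range_eq.trans hker.symm
    rightHom_surjective := hπ }, range_eq⟩

theorem injOn_zpowers_of_orderOf_map_eq {A : Type*} [Group A] {θ : G →* A} {z : G}
    (h : orderOf (θ z) = orderOf z) : Set.InjOn θ (Subgroup.zpowers z) := by
  rintro _ ⟨i, rfl⟩ _ ⟨j, rfl⟩ hij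
  simp only [map_zpow] at hij
  rwa [zpow_eq_zpow_iff_modEq, h, ← zpow_eq_zpow_iff_modEq] at hij

variable {K : Type} [Field K] [IsSepClosed K]

theorem twistIsomorphic_of_ker_eq_zpowers {A B : Type} [CommGroup A] [CommGroup B]
    [Finite A] [Finite B] [NeZero (Nat.card A : K)] [NeZero (Nat.card B : K)]
    {π : G →* Q} {ρ : H →* Q} (hπ : Function.Surjective π) (hρ : Function.Surjective ρ)
    {z : G} {w : H} (hπz : π.ker = Subgroup.zpowers z) (hρw : ρ.ker = Subgroup.zpowers w)
    (hz : z ∈ epicentre K G) (hw : w ∈ epicentre K H) (hzw : orderOf z = orderOf w)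
    (θ : G →* A) (η : H →* B) (hθ : orderOf (θ z) = orderOf z) (hη : orderOf (η w) = orderOf w) :
    TwistIsomorphic K G H := by
  have hN : Nat.card (Subgroup.zpowers (θ z)) = orderOf z := by rw [Nat.card_zpowers, hθ]
  obtain ⟨S, hS⟩ := exists_groupExtension_of_ker_eq_zpowers hπ hπz hN.symm
  obtain ⟨T, hT⟩ := exists_groupExtension_of_ker_eq_zpowers hρ hρw (hzw.symm.trans hN.symm)
  have : NeZero (Nat.card (Subgroup.zpowers (θ z)) : K) :=
    ⟨ne_zero_of_dvd_ne_zero (NeZero.ne (Nat.card A : K))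
      (Nat.cast_dvd_cast (Subgroup.card_subgroup_dvd_card _))⟩
  have hθS : Function.Injective (θ.comp S.inl) := fun _ _ h =>
    S.inl_injective (injOn_zpowers_of_orderOf_map_eq hθ (hS.le ⟨_, rfl⟩) (hS.le ⟨_, rfl⟩) h)
  have hηT : Function.Injective (η.comp T.inl) := fun _ _ h =>
    T.inl_injective (injOn_zpowers_of_orderOf_map_eq hη (hT.le ⟨_, rfl⟩) (hT.le ⟨_, rfl⟩) h)
  refine twistIsomorphic_of_groupExtension S T ?_ ?_
    (exists_extension_of_injective_comp S hθS) (exists_extension_of_injective_comp T hηT)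
  · rwa [hS, Subgroup.zpowers_le]
  · rwa [hT, Subgroup.zpowers_le]

end CyclicKernel

section ProductGroups

variable {G H Q : Type*} [Group G] [Group H] [Group Q]

theorem closure_inl_union_inr {S : Set G} {T : Set H} (hS : Subgroup.closure S = ⊤)
    (hT : Subgroup.closure T = ⊤) :
    Subgroup.closure (MonoidHom.inl G H '' S ∪ MonoidHom.inr G H '' T) = ⊤ := by
  rw [Subgroup.closure_union, ← MonoidHom.map_closure, ← MonoidHom.map_closure, hS, hT,
    ← top_le_iff, ← Subgroup.top_prod_top, Subgroup.prod_le_iff]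
  exact ⟨le_sup_left, le_sup_right⟩

theorem ker_prodMap_id_right (π : G →* Q) :
    (π.prodMap (MonoidHom.id H)).ker = π.ker.map (MonoidHom.inl G H) := by
  ext ⟨g, h⟩
  simp [Prod.ext_iff, MonoidHom.mem_ker, eq_comm]

theorem ker_prodMap_id_left (π : G →* Q) :
    ((MonoidHom.id H).prodMap π).ker = π.ker.map (MonoidHom.inr H G) := by
  ext ⟨g, h⟩
  simp [Prod.ext_iff, MonoidHom.mem_ker, eq_comm, and_comm]

theorem orderOf_inl (g : G) : orderOf (MonoidHom.inl G H g) = orderOf g :=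
  orderOf_injective _ (Prod.mk_left_injective 1) g

theorem orderOf_inr (h : H) : orderOf (MonoidHom.inr G H h) = orderOf h :=
  orderOf_injective _ (Prod.mk_right_injective 1) h

theorem ker_eq_zpowers_pow_orderOf {t : G} (ht : Subgroup.zpowers t = ⊤) (π : G →* Q) :
    π.ker = Subgroup.zpowers (t ^ orderOf (π t)) := by
  refine le_antisymm (fun x hx => ?_) ?_
  · obtain ⟨j, rfl⟩ := Subgroup.mem_zpowers_iff.1 (ht ▸ Subgroup.mem_top x)
    rw [MonoidHom.mem_ker, map_zpow, ← orderOf_dvd_iff_zpow_eq_one] at hx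
    obtain ⟨k, rfl⟩ := hx
    exact ⟨k, by rw [zpow_mul, zpow_natCast]⟩
  · rw [Subgroup.zpowers_le, MonoidHom.mem_ker, map_pow, pow_orderOf_eq_one]

end ProductGroups

section CyclicGroups

open Multiplicative

theorem zpowers_ofAdd_one (n : ℕ) : Subgroup.zpowers (ofAdd (1 : ZMod n)) = ⊤ := by
  rw [Subgroup.eq_top_iff']
  intro x
  obtain ⟨k, hk⟩ := ZMod.intCast_surjective x.toAdd
  refine Subgroup.mem_zpowers_iff.2 ⟨k, ?_⟩
  rw [← ofAdd_zsmul, zsmul_one, hk, ofAdd_toAdd]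

theorem orderOf_ofAdd_one (n : ℕ) : orderOf (ofAdd (1 : ZMod n)) = n := by
  rw [orderOf_ofAdd_eq_addOrderOf, ZMod.addOrderOf_one]

theorem ofAdd_one_pow (n : ℕ) : ofAdd (1 : ZMod n) ^ n = 1 := by
  rw [← orderOf_dvd_iff_pow_eq_one, orderOf_ofAdd_one]

/-- The reduction `C_m → C_k` for `k ∣ m`. -/
def cyclicReduction {k m : ℕ} (h : k ∣ m) : Multiplicative (ZMod m) →* Multiplicative (ZMod k) :=
  (ZMod.castHom h (ZMod k)).toAddMonoidHom.toMultiplicative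

variable {k m : ℕ} (h : k ∣ m)

theorem cyclicReduction_surjective : Function.Surjective (cyclicReduction h) :=
  ZMod.castHom_surjective h

theorem cyclicReduction_ofAdd_one : cyclicReduction h (ofAdd 1) = ofAdd 1 :=
  congrArg ofAdd (map_one (ZMod.castHom h (ZMod k)))

theorem ker_cyclicReduction :
    (cyclicReduction h).ker = Subgroup.zpowers (ofAdd 1 ^ k) := by
  rw [ker_eq_zpowers_pow_orderOf (zpowers_ofAdd_one m), cyclicReduction_ofAdd_one,
    orderOf_ofAdd_one]

end CyclicGroups

open Phi2Gen

/-- The images `f α`, `f α₁`, `f α₂` in a group satisfy the relations `phi2Rels p m`. -/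
structure SatisfiesPhi2Rels {Γ : Type*} [Group Γ] (p m : ℕ) (f : Phi2Gen → Γ) : Prop where
  commutator : ⁅f a₁, f a⁆ = f a₂
  commute_a : Commute (f a) (f a₂)
  commute_a₁ : Commute (f a₁) (f a₂)
  pow_a : f a ^ m = 1
  pow_a₁ : f a₁ ^ p = 1
  pow_a₂ : f a₂ ^ p = 1

namespace SatisfiesPhi2Rels

variable {Γ Δ : Type*} [Group Γ] [Group Δ] {p m : ℕ} {f : Phi2Gen → Γ}

theorem iff_lift_eq_one :
    SatisfiesPhi2Rels p m f ↔ ∀ r ∈ phi2Rels p m, FreeGroup.lift f r = 1 := by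
  simp only [phi2Rels, Set.mem_insert_iff, Set.mem_singleton_iff, forall_eq_or_imp, forall_eq,
    map_mul, map_inv, map_pow, map_commutatorElement, FreeGroup.lift_apply_of, mul_inv_eq_one,
    commutatorElement_eq_one_iff_commute]
  exact ⟨fun ⟨h₁, h₂, h₃, h₄, h₅, h₆⟩ => ⟨h₁, h₂, h₃, h₄, h₅, h₆⟩,
    fun ⟨h₁, h₂, h₃, h₄, h₅, h₆⟩ => ⟨h₁, h₂, h₃, h₄, h₅, h₆⟩⟩

theorem of (p m : ℕ) :
    SatisfiesPhi2Rels p m (PresentedGroup.of : Phi2Gen → PresentedGroup (phi2Rels p m)) :=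
  iff_lift_eq_one.2 fun _ hr =>
    (FreeGroup.lift_unique (PresentedGroup.mk _) fun _ => rfl).symm.trans
      (PresentedGroup.one_of_mem hr)

/-- The homomorphism from the presented group given by its universal property. -/
def lift (h : SatisfiesPhi2Rels p m f) : PresentedGroup (phi2Rels p m) →* Γ :=
  PresentedGroup.toGroup (iff_lift_eq_one.1 h)

theorem lift_of (h : SatisfiesPhi2Rels p m f) (i : Phi2Gen) : h.lift (.of i) = f i :=
  PresentedGroup.toGroup.of _

theorem map (h : SatisfiesPhi2Rels p m f) (φ : Γ →* Δ) {k : ℕ} (hk : φ (f a) ^ k = 1) :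
    SatisfiesPhi2Rels p k (φ ∘ f) where
  commutator := by
    simp only [Function.comp_apply, ← map_commutatorElement, h.commutator]
  commute_a := h.commute_a.map φ
  commute_a₁ := h.commute_a₁.map φ
  pow_a := hk
  pow_a₁ := by rw [Function.comp_apply, ← map_pow, h.pow_a₁, map_one]
  pow_a₂ := by rw [Function.comp_apply, ← map_pow, h.pow_a₂, map_one]

theorem of_dvd {k : ℕ} (h : SatisfiesPhi2Rels p k f) (hkm : k ∣ m) : SatisfiesPhi2Rels p m f where
  __ := h
  pow_a := orderOf_dvd_iff_pow_eq_one.1 ((orderOf_dvd_of_pow_eq_one h.pow_a).trans hkm)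

theorem pow_eq_one (h : SatisfiesPhi2Rels p p f) (i : Phi2Gen) : f i ^ p = 1 := by
  cases i with
  | a => exact h.pow_a
  | a₁ => exact h.pow_a₁
  | a₂ => exact h.pow_a₂

theorem pow_a_mem_center (h : SatisfiesPhi2Rels p m f) (hf : Subgroup.closure (Set.range f) = ⊤) :
    f a ^ p ∈ Subgroup.center Γ := by
  rw [← Subgroup.centralizer_univ, ← Subgroup.coe_top, ← hf, Subgroup.centralizer_closure,
    Subgroup.mem_centralizer_iff]
  rintro _ ⟨_ | _ | _, rfl⟩
  · exact (Commute.refl (f a)).pow_right p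
  · change Commute _ _
    rw [← commutatorElement_eq_one_iff_commute,
      commutatorElement_pow_right (h.commutator ▸ h.commute_a.symm), h.commutator, h.pow_a₂]
  · exact h.commute_a.symm.pow_right p

end SatisfiesPhi2Rels

section Phi2Groups

variable {p k m : ℕ}

/-- The quotient map `⟨α, α₁, α₂ ∣ phi2Rels p m⟩ → ⟨α, α₁, α₂ ∣ phi2Rels p k⟩` for `k ∣ m`. -/
def phi2Reduction (h : k ∣ m) : PresentedGroup (phi2Rels p m) →* PresentedGroup (phi2Rels p k) :=
  ((SatisfiesPhi2Rels.of p k).of_dvd h).lift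

theorem phi2Reduction_of (h : k ∣ m) (i : Phi2Gen) :
    phi2Reduction h (.of i : PresentedGroup (phi2Rels p m)) = .of i :=
  SatisfiesPhi2Rels.lift_of _ i

theorem phi2Reduction_surjective (h : k ∣ m) :
    Function.Surjective (phi2Reduction h : PresentedGroup (phi2Rels p m) →* _) := by
  rw [← MonoidHom.range_eq_top, ← top_le_iff, ← PresentedGroup.closure_range_of,
    Subgroup.closure_le]
  rintro _ ⟨i, rfl⟩
  exact ⟨.of i, phi2Reduction_of h i⟩

theorem ker_phi2Reduction (hpk : p ∣ k) (h : k ∣ m) :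
    (phi2Reduction h : PresentedGroup (phi2Rels p m) →* _).ker =
      Subgroup.zpowers (.of a ^ k) := by
  set N : Subgroup (PresentedGroup (phi2Rels p m)) := Subgroup.zpowers (.of a ^ k) with hN
  have le_center : N ≤ Subgroup.center _ := by
    obtain ⟨j, rfl⟩ := hpk
    rw [hN, Subgroup.zpowers_le, pow_mul]
    exact pow_mem ((SatisfiesPhi2Rels.of p m).pow_a_mem_center
      (PresentedGroup.closure_range_of _)) j
  have : N.Normal := ⟨fun x hx g => by
    rwa [Subgroup.mem_center_iff.1 (le_center hx) g, mul_inv_cancel_right]⟩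
  have hq : QuotientGroup.mk' N (.of a) ^ k = 1 := by
    rw [← map_pow, QuotientGroup.mk'_apply, QuotientGroup.eq_one_iff]
    exact Subgroup.mem_zpowers _
  let σ := ((SatisfiesPhi2Rels.of p m).map (QuotientGroup.mk' N) hq).lift
  have section_comp : σ.comp (phi2Reduction h) = QuotientGroup.mk' N :=
    PresentedGroup.ext fun i => by
      rw [MonoidHom.comp_apply, phi2Reduction_of]
      exact SatisfiesPhi2Rels.lift_of _ i
  refine le_antisymm ?_ ?_
  · calc (phi2Reduction h).ker ≤ σ.ker.comap (phi2Reduction h) := Subgroup.ker_le_comap _ _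
      _ = (σ.comp (phi2Reduction h)).ker := MonoidHom.comap_ker _ _
      _ = N := by rw [section_comp, QuotientGroup.ker_mk']
  · rw [hN, Subgroup.zpowers_le, MonoidHom.mem_ker, map_pow, phi2Reduction_of]
    exact (SatisfiesPhi2Rels.of p k).pow_a

/-- The homomorphism onto `C_m` with `α ↦ 1`, `α₁ ↦ 0` and `α₂ ↦ 0`. -/
def phi2Degree (p m : ℕ) : PresentedGroup (phi2Rels p m) →* Multiplicative (ZMod m) :=
  SatisfiesPhi2Rels.lift (f := fun | a => Multiplicative.ofAdd 1 | a₁ => 1 | a₂ => 1)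
    { commutator := commutatorElement_one_left _
      commute_a := Commute.one_right _
      commute_a₁ := Commute.one_right _
      pow_a := ofAdd_one_pow m
      pow_a₁ := one_pow p
      pow_a₂ := one_pow p }

theorem phi2Degree_of_a : phi2Degree p m (.of a) = Multiplicative.ofAdd 1 :=
  SatisfiesPhi2Rels.lift_of _ a

theorem orderOf_of_a : orderOf (.of a : PresentedGroup (phi2Rels p m)) = m := by
  refine Nat.dvd_antisymm (orderOf_dvd_of_pow_eq_one (SatisfiesPhi2Rels.of p m).pow_a) ?_
  simpa only [phi2Degree_of_a, orderOf_ofAdd_one] using orderOf_map_dvd (phi2Degree p m) (.of a)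

end Phi2Groups

section EpicentreOfProducts

variable {R G A : Type} [CommRing R] [Group G] [Group A] {n : ℕ}

theorem inr_pow_mem_epicentre (hn : Odd n) {S : Set G} (hS : Subgroup.closure S = ⊤)
    (hpow : ∀ s ∈ S, s ^ n = 1) {t : A} (ht : Subgroup.zpowers t = ⊤) :
    MonoidHom.inr G A (t ^ n) ∈ epicentre R (G × A) := by
  rw [Subgroup.zpowers_eq_closure] at ht
  rw [map_pow]
  refine pow_mem_epicentre hn (closure_inl_union_inr hS ht) ?_
  rintro _ (⟨s, hs, rfl⟩ | ⟨_, rfl, rfl⟩) hne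
  · have hcomm : ⁅MonoidHom.inr G A t, MonoidHom.inl G A s⁆ = 1 :=
      commutatorElement_eq_one_iff_commute.2 (MonoidHom.commute_inl_inr s t).symm
    rw [hcomm, ← map_pow, hpow s hs, map_one]
    exact ⟨Commute.one_right _, Commute.one_right _, rfl⟩
  · exact absurd rfl hne

theorem SatisfiesPhi2Rels.inl_pow_mem_epicentre {m : ℕ} {f : Phi2Gen → G}
    (h : SatisfiesPhi2Rels n m f) (hf : Subgroup.closure (Set.range f) = ⊤) (hn : Odd n) {t : A}
    (ht : Subgroup.zpowers t = ⊤) (htn : t ^ n = 1) :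
    MonoidHom.inl G A (f a ^ n) ∈ epicentre R (G × A) := by
  rw [Subgroup.zpowers_eq_closure] at ht
  rw [map_pow]
  refine pow_mem_epicentre hn (closure_inl_union_inr hf ht) ?_
  rintro _ (⟨_, ⟨i, rfl⟩, rfl⟩ | ⟨_, rfl, rfl⟩) hne
  · obtain ⟨hα, hi, hpow⟩ :
        Commute (f a) ⁅f a, f i⁆ ∧ Commute (f i) ⁅f a, f i⁆ ∧ f i ^ n = 1 := by
      cases i with
      | a => exact absurd rfl hne
      | a₁ =>
        rw [← commutatorElement_inv, h.commutator]
        exact ⟨h.commute_a.inv_right, h.commute_a₁.inv_right, h.pow_a₁⟩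
      | a₂ =>
        rw [commutatorElement_eq_one_iff_commute.2 h.commute_a]
        exact ⟨Commute.one_right _, Commute.one_right _, h.pow_a₂⟩
    rw [← map_commutatorElement, ← map_pow, hpow, map_one]
    exact ⟨hα.map _, hi.map _, rfl⟩
  · rw [commutatorElement_eq_one_iff_commute.2 (MonoidHom.commute_inl_inr (f a) _), ← map_pow,
      htn, map_one]
    exact ⟨Commute.one_right _, Commute.one_right _, rfl⟩

end EpicentreOfProducts

theorem mainTheorem4_general {K : Type} [Field K] [IsSepClosed K] {n m : ℕ} (hn : Odd n)
    (hnm : n ∣ m) [NeZero (m : K)] :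
    TwistIsomorphic K (ES n × Multiplicative (ZMod m))
      (PresentedGroup (phi2Rels n m) × Multiplicative (ZMod n)) := by
  have : NeZero m := .of_neZero_natCast K
  have : NeZero (Nat.card (Multiplicative (ZMod m)) : K) := by
    rwa [show Nat.card (Multiplicative (ZMod m)) = m from Nat.card_zmod m]
  have orderOf_pow_eq : orderOf (.of a ^ n : PresentedGroup (phi2Rels n m)) =
      orderOf (Multiplicative.ofAdd (1 : ZMod m) ^ n) := by
    rw [orderOf_pow' _ hn.pos.ne', orderOf_pow' _ hn.pos.ne', orderOf_of_a, orderOf_ofAdd_one]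
  refine twistIsomorphic_of_ker_eq_zpowers
    (π := MonoidHom.prodMap (.id (ES n)) (cyclicReduction hnm))
    (ρ := MonoidHom.prodMap (phi2Reduction hnm) (.id (Multiplicative (ZMod n))))
    (z := MonoidHom.inr _ _ (.ofAdd 1 ^ n)) (w := MonoidHom.inl _ _ (.of a ^ n))
    (Function.surjective_id.prodMap (cyclicReduction_surjective hnm))
    ((phi2Reduction_surjective hnm).prodMap Function.surjective_id) ?_ ?_ ?_ ?_ ?_
    (MonoidHom.snd _ _) ((phi2Degree n m).comp (MonoidHom.fst _ _)) ?_ ?_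
  · rw [ker_prodMap_id_left, ker_cyclicReduction, MonoidHom.map_zpowers]
  · rw [ker_prodMap_id_right, ker_phi2Reduction dvd_rfl, MonoidHom.map_zpowers]
  · exact inr_pow_mem_epicentre hn (PresentedGroup.closure_range_of _)
      (Set.forall_mem_range.2 (SatisfiesPhi2Rels.of n n).pow_eq_one) (zpowers_ofAdd_one m)
  · exact (SatisfiesPhi2Rels.of n m).inl_pow_mem_epicentre
      (PresentedGroup.closure_range_of _) hn (zpowers_ofAdd_one n) (ofAdd_one_pow n)
  · rw [orderOf_inr, orderOf_inl, orderOf_pow_eq]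
  · exact (orderOf_inr _).symm
  · change orderOf (phi2Degree n m (.of a ^ n)) = _
    rw [orderOf_inl, orderOf_pow_eq, map_pow, phi2Degree_of_a]

end

theorem mainTheorem4 (p : ℕ) (hp : p.Prime) (hodd : p ≠ 2) :
    TwistIsomorphic ℂ (Phi2_2111d p) (Phi2_2111c p) :=
  have : NeZero p := ⟨hp.ne_zero⟩
  mainTheorem4_general (hp.odd_of_ne_two hodd) (dvd_pow_self p two_ne_zero)
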